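/- Let $n\ge 2$, let $J$ be the $n\times n$ Jordan block with eigenvalue $0$ (ones on the superdiagonal, zeros elsewhere), and let $\|\cdot\|_2$ be the matrix norm induced by the Euclidean norm. A (finite) Blaschke product of degree $m\ge 0$ is a function $B(z)=e^{i\gamma}\prod_{j=1}^m\frac{z-\alpha_j}{1-\overline{\alpha_j}z}$ with $\gamma\in\mathbb R$ and $|\alpha_j|<1$. Given a conformal map $\phi$ of the interior of the numerical range $W(A)=\{q^*Aq:\|q\|_2=1\}$ onto the open unit disk, $B$ is called extremal for $A$ and $\phi$ if $\hat f=B\circ\phi$ maximizes $\|f(A)\|_2$ over all functions $f$ that are analytic in the interior of $W(A)$ with $\|f\|_\infty=\sup_{z\in\operatorname{int}W(A)}|f(z)|=1$. Then: 1. $W(J)$ is the closed disk centered at $0$ of radius $\cos(\pi/(n+1))$, and $\phi(z)=z/\cos(\pi/(n+1))$ maps the interior of $W(J)$ conformally onto the open unit disk and extends continuously to a bijection of $W(J)$ onto the closed unit disk. 2. Every finite Blaschke product $B$, of any degree, satisfies $\|B(\phi(J))\|_2\le \sec(\pi/(n+1))^{\,n-1}$, and equality holds for $B(z)=z^{n-1}$.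 3. The Blaschke product $z^{n-1}$ is extremal for $J$ and $\phi$. It is the unique one of degree at most $n-1$ up to a unimodular scalar: for a Blaschke product $B$ of degree at most $n-1$, the following are equivalent: (a) $B$ is extremal; (b) $\|B(\phi(J))\|_2=\sec(\pi/(n+1))^{\,n-1}$; (c) $B(z)=u\,z^{n-1}$ on the closed unit disk for some $u\in\mathbb C$ with $|u|=1$. -/

import Mathlib

open Polynomial
open scoped Matrix.Norms.L2Operator

/-- The `n × n` Jordan block with eigenvalue `0`: ones on the superdiagonal, zeros elsewhere. -/
def jordanBlock (n : ℕ) : Matrix (Fin n) (Fin n) ℂ :=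
  Matrix.of fun i j => if (i : ℕ) + 1 = (j : ℕ) then 1 else 0

/-- The numerical range `W(A) = {q* A q : ‖q‖₂ = 1}`. -/
def numericalRange {n : ℕ} (A : Matrix (Fin n) (Fin n) ℂ) : Set ℂ :=
  {z | ∃ q : EuclideanSpace ℂ (Fin n), ‖q‖ = 1 ∧ z = star q.ofLp ⬝ᵥ A.mulVec q.ofLp}

/-- The polynomial `p` agrees with `f` at every eigenvalue of the `n × n` matrix `A`,
together with all derivatives of order less than `n`. -/
def IsHermiteInterpolant {n : ℕ} (f : ℂ → ℂ) (A : Matrix (Fin n) (Fin n) ℂ) (p : ℂ[X]) : Prop :=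
  ∀ z ∈ spectrum ℂ A, ∀ k < n, (derivative^[k] p).eval z = iteratedDeriv k f z

theorem pow_dvd_iff_iterate_derivative_eval {q : ℂ[X]} {n : ℕ} {a : ℂ} :
    (X - C a) ^ n ∣ q ↔ ∀ k < n, (derivative^[k] q).eval a = 0 := by
  rcases eq_or_ne q 0 with rfl | hq
  · simp
  rw [← Polynomial.le_rootMultiplicity_iff hq]
  cases n with
  | zero => simp
  | succ m =>
    rw [Nat.succ_le_iff, Polynomial.lt_rootMultiplicity_iff_isRoot_iterate_derivative hq]
    simp [Polynomial.IsRoot]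

theorem exists_isHermiteInterpolant {n : ℕ} (f : ℂ → ℂ) (A : Matrix (Fin n) (Fin n) ℂ) :
    ∃ p : ℂ[X], IsHermiteInterpolant f A p := by
  classical
  have hfin : (spectrum ℂ A).Finite := Matrix.finite_spectrum A
  let t : ℂ → ℂ[X] := fun a =>
    ∑ k ∈ Finset.range n, C (iteratedDeriv k f a / (k.factorial : ℂ)) * (X - C a) ^ k
  have ht : ∀ a, ∀ k < n, (derivative^[k] (t a)).eval a = iteratedDeriv k f a := by
    intro a k hk
    simp only [t, Polynomial.iterate_derivative_sum, Polynomial.eval_finsetSum,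
      Polynomial.iterate_derivative_C_mul, Polynomial.iterate_derivative_X_sub_pow,
      Polynomial.eval_mul, Polynomial.eval_C]
    rw [Finset.sum_eq_single k]
    · have h0 : (k.factorial : ℂ) ≠ 0 := Nat.cast_ne_zero.2 (Nat.factorial_ne_zero k)
      simp [Nat.descFactorial_self, h0]
    · intro b _ hb
      rcases lt_or_gt_of_ne hb with h | h
      · simp [Nat.descFactorial_eq_zero_iff_lt.2 h]
      · simp [Nat.sub_ne_zero_of_lt h]
    · intro h
      exact absurd (Finset.mem_range.2 hk) h
  have : Finite (spectrum ℂ A) := hfin.to_subtype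
  obtain ⟨p, hp⟩ := Ideal.exists_forall_sub_mem_ideal
    (I := fun a : spectrum ℂ A => Ideal.span {(X - C (a : ℂ)) ^ n})
    (by
      intro a b hab
      refine (Ideal.isCoprime_span_singleton_iff _ _).2 ?_
      exact (Polynomial.isCoprime_X_sub_C_of_isUnit_sub
        (sub_ne_zero.2 (Subtype.coe_injective.ne hab)).isUnit).pow) (fun a => t a)
  refine ⟨p, fun z hz k hk => ?_⟩
  have h1 := pow_dvd_iff_iterate_derivative_eval.1
    (Ideal.mem_span_singleton.1 (hp ⟨z, hz⟩)) k hk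
  rw [Polynomial.iterate_derivative_sub, Polynomial.eval_sub, sub_eq_zero] at h1
  rw [h1, ht z k hk]

/-- The matrix function `f(A)`, for `f` analytic near the eigenvalues of `A`: the value `p(A)`
of any polynomial `p` that agrees with `f` on the spectrum of `A` in the sense of Hermite
interpolation. -/
noncomputable def matrixFun {n : ℕ} (f : ℂ → ℂ) (A : Matrix (Fin n) (Fin n) ℂ) :
    Matrix (Fin n) (Fin n) ℂ :=
  aeval A (exists_isHermiteInterpolant f A).choose

/-- `f(A)` does not depend on the interpolating polynomial. -/
theorem matrixFun_eq_aeval {n : ℕ} {f : ℂ → ℂ} {A : Matrix (Fin n) (Fin n) ℂ} {p : ℂ[X]}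
    (hp : IsHermiteInterpolant f A p) : matrixFun f A = aeval A p := by
  classical
  have hc := (exists_isHermiteInterpolant f A).choose_spec
  rw [matrixFun, ← sub_eq_zero, ← map_sub]
  set q := (exists_isHermiteInterpolant f A).choose - p with hq
  rcases eq_or_ne q 0 with h0 | h0
  · simp [h0]
  have hdvd : A.charpoly ∣ q := by
    refine (IsAlgClosed.splits A.charpoly).dvd_of_roots_le_roots A.charpoly_monic.ne_zero ?_
    rw [Multiset.le_iff_count]
    intro z
    by_cases hz : z ∈ A.charpoly.roots
    · have hz' : z ∈ spectrum ℂ A :=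
        Matrix.mem_spectrum_of_isRoot_charpoly (Polynomial.isRoot_of_mem_roots hz)
      have h1 : (X - C z) ^ n ∣ q := by
        rw [pow_dvd_iff_iterate_derivative_eval]
        intro k hk
        rw [hq, Polynomial.iterate_derivative_sub, Polynomial.eval_sub, hc z hz' k hk,
          hp z hz' k hk, sub_self]
      rw [Polynomial.count_roots q]
      refine le_trans ?_ ((Polynomial.le_rootMultiplicity_iff h0).2 h1)
      refine (Multiset.count_le_card _ _).trans ((Polynomial.card_roots' _).trans ?_)
      simp
    · simp [Multiset.count_eq_zero_of_notMem hz]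
  obtain ⟨r, hr⟩ := hdvd
  rw [hr, map_mul, Matrix.aeval_self_charpoly, zero_mul]

/-- `B` is, on the closed unit disk, a finite Blaschke product with exactly `m` factors:
`B(z) = exp(iγ) ∏ⱼ (z - αⱼ) / (1 - conj(αⱼ) z)` with `|αⱼ| < 1`. -/
def IsBlaschkeProduct (m : ℕ) (B : ℂ → ℂ) : Prop :=
  ∃ (γ : ℝ) (α : Fin m → ℂ), (∀ j, ‖α j‖ < 1) ∧
    ∀ z ∈ Metric.closedBall (0 : ℂ) 1,
      B z = Complex.exp (Complex.I * γ) * ∏ j, (z - α j) / (1 - star (α j) * z)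

/-- `φ` is a conformal map of the interior of `W` onto the open unit disk that extends
continuously to a bijection of `W` onto the closed unit disk. -/
def IsConformalOntoDisk (W : Set ℂ) (φ : ℂ → ℂ) : Prop :=
  DifferentiableOn ℂ φ (interior W) ∧
    Set.BijOn φ (interior W) (Metric.ball 0 1) ∧
    ContinuousOn φ W ∧
    Set.BijOn φ W (Metric.closedBall 0 1)

/-- `f ∈ H^∞(W)` with `‖f‖_∞ = 1`: `f` is analytic in the interior of `W` and the supremum of
`|f|` there is `1`. -/
def IsUnitHInfty (W : Set ℂ) (f : ℂ → ℂ) : Prop :=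
  DifferentiableOn ℂ f (interior W) ∧ IsLUB ((fun z => ‖f z‖) '' interior W) 1

/-- `B` is extremal for `A` and the conformal map `φ`: `B ∘ φ` maximizes `‖f(A)‖₂` over all
`f ∈ H^∞(W(A))` with `‖f‖_∞ = 1`. -/
def IsExtremal {n : ℕ} (A : Matrix (Fin n) (Fin n) ℂ) (φ B : ℂ → ℂ) : Prop :=
  IsUnitHInfty (numericalRange A) (B ∘ φ) ∧
    ∀ f : ℂ → ℂ, IsUnitHInfty (numericalRange A) f →
      ‖matrixFun f A‖ ≤ ‖matrixFun (B ∘ φ) A‖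

/-- The scaling `φ(z) = z / cos(π / (n + 1))`. -/
noncomputable def jordanConformal (n : ℕ) (z : ℂ) : ℂ :=
  z / ((Real.cos (Real.pi / (n + 1)) : ℝ) : ℂ)

/-! Let `b = sec(π/(n+1))`, and let `g` be analytic on the unit disk, bounded by 1, with Taylor
coefficients `a k`. Since `J` is nilpotent, `g(bJ) = ∑ a_k b^k J^k`. With `D = diag(1, b, …,
b^(n-1))` this equals `D⁻¹ T D`, where `T = ∑ a_k J^k` is a Toeplitz matrix. Multiplication by `g`
contracts `H²`, so `‖T‖ ≤ 1`; as `‖D⁻¹‖ ≤ 1` and `‖D‖ = b^(n-1)`, the bound follows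
(`IsSchurSeries.sum_sq_norm_weighted_le`).

When equality holds and `b > 1`, a maximizing vector must live on the last coordinate and its image
on the first. This forces `|a (n-1)| = 1`, and `∑ |a k|² ≤ 1` leaves no other coefficient: `g` is a
unimodular multiple of `z^(n-1)` (`IsSchurSeries.eq_monomial`). The argument serves all bounded
analytic functions, so extremality and the equality case for Blaschke products come from the same
lemma.

For the numerical range, the form `∑ conj(x_j) x_(j+1)` is bounded by a weighted AM-GM inequality
whose weights come from the sine eigenvector of the path graph (`sum_mul_succ_le`). Every smaller
modulus occurs by the intermediate value theorem, and every argument by a diagonal unitary. -/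

/-! ### Contractivity of multiplication on `H²` -/

theorem Finset.sum_le_sum_of_nonneg_of_ne_zero {ι : Type*} {f : ι → ℝ} {s t : Finset ι}
    (h0 : ∀ i, 0 ≤ f i) (h : ∀ i ∈ s, f i ≠ 0 → i ∈ t) : ∑ i ∈ s, f i ≤ ∑ i ∈ t, f i := by
  classical
  rw [← Finset.sum_filter_ne_zero (s := s)]
  refine Finset.sum_le_sum_of_subset_of_nonneg (fun i hi => ?_) fun i _ _ => h0 i
  exact h i (Finset.mem_filter.1 hi).1 (Finset.mem_filter.1 hi).2

/-- Parseval's inequality for the product of a bounded polynomial with another polynomial. -/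
theorem Polynomial.sum_range_sq_norm_coeff_mul_le (p w : ℂ[X]) {M : ℝ}
    (hp : ∀ z : ℂ, ‖z‖ = 1 → ‖p.eval z‖ ≤ M) (N : ℕ) :
    ∑ i ∈ Finset.range N, ‖(p * w).coeff i‖ ^ 2 ≤ M ^ 2 * ∑ i ∈ w.support, ‖w.coeff i‖ ^ 2 := by
  have hint : ∀ q : ℂ[X], CircleIntegrable (fun z => ‖q.eval z‖ ^ 2) 0 1 := fun q =>
    ContinuousOn.circleIntegrable zero_le_one (by fun_prop)
  calc ∑ i ∈ Finset.range N, ‖(p * w).coeff i‖ ^ 2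
      ≤ ∑ i ∈ (p * w).support, ‖(p * w).coeff i‖ ^ 2 := by
        refine Finset.sum_le_sum_of_nonneg_of_ne_zero (fun _ => by positivity) fun i _ hi => ?_
        rw [Polynomial.mem_support_iff]
        intro h
        simp [h] at hi
    _ = Real.circleAverage (fun z => ‖(p * w).eval z‖ ^ 2) 0 1 :=
        (p * w).sum_sq_norm_coeff_eq_circleAverage
    _ ≤ Real.circleAverage (M ^ 2 • fun z => ‖w.eval z‖ ^ 2) 0 1 := by
        refine Real.circleAverage_mono (hint _) ((hint w).const_smul) fun z hz => ?_
        have hz' : ‖z‖ = 1 := by simpa using hz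
        simp only [eval_mul, norm_mul, mul_pow, Pi.smul_apply, smul_eq_mul]
        gcongr
        exact hp z hz'
    _ = M ^ 2 * ∑ i ∈ w.support, ‖w.coeff i‖ ^ 2 := by
        rw [Real.circleAverage_smul, w.sum_sq_norm_coeff_eq_circleAverage, smul_eq_mul]

/-- The power series with coefficients `a` converges to `g` on the open unit disk, and `g` is
bounded by `1` there. -/
structure IsSchurSeries (a : ℕ → ℂ) (g : ℂ → ℂ) : Prop where
  hasSum : ∀ z : ℂ, ‖z‖ < 1 → HasSum (fun k => a k * z ^ k) (g z)
  norm_le : ∀ z : ℂ, ‖z‖ < 1 → ‖g z‖ ≤ 1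

namespace IsSchurSeries

variable {a : ℕ → ℂ} {g : ℂ → ℂ}

/-- On a circle of radius `r < 1` the series converges absolutely, so its partial sums are bounded
by 1 plus a tail tending to 0. Parseval applies to these polynomials, and their first `N` product
coefficients no longer change once the degree cutoff reaches `N`. -/
theorem sum_sq_norm_antidiagonal_le_of_lt (h : IsSchurSeries a g) (w : ℂ[X]) (N : ℕ) {r : ℝ}
    (hr0 : 0 ≤ r) (hr1 : r < 1) :
    ∑ i ∈ Finset.range N,
        ‖∑ x ∈ Finset.HasAntidiagonal.antidiagonal i, a x.1 * (r : ℂ) ^ x.1 * w.coeff x.2‖ ^ 2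
      ≤ ∑ i ∈ w.support, ‖w.coeff i‖ ^ 2 := by
  have hnr : ‖(r : ℂ)‖ = r := by simp [abs_of_nonneg hr0]
  have hs : Summable fun k => ‖a k * (r : ℂ) ^ k‖ := (h.hasSum r (by rwa [hnr])).summable.norm
  let P : ℕ → ℂ[X] := fun m => ∑ k ∈ Finset.range m, C (a k * (r : ℂ) ^ k) * X ^ k
  let t : ℕ → ℝ := fun m => ∑' k, ‖a (k + m) * (r : ℂ) ^ (k + m)‖
  have ht : Filter.Tendsto t Filter.atTop (nhds 0) :=
    tendsto_sum_nat_add fun k => ‖a k * (r : ℂ) ^ k‖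
  have hP : ∀ m, ∀ z : ℂ, ‖z‖ = 1 → ‖(P m).eval z‖ ≤ 1 + t m := by
    intro m z hz
    have hz1 : ‖(r : ℂ) * z‖ < 1 := by rw [norm_mul, hnr, hz, mul_one]; exact hr1
    have hsum := h.hasSum _ hz1
    have h1 := hsum.summable.sum_add_tsum_nat_add m
    rw [hsum.tsum_eq] at h1
    have h2 : (P m).eval z = ∑ k ∈ Finset.range m, a k * ((r : ℂ) * z) ^ k := by
      simp only [P, eval_finsetSum, eval_mul, eval_C, eval_pow, eval_X, mul_pow, mul_assoc]
    rw [h2, eq_sub_of_add_eq h1]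
    refine (norm_sub_le _ _).trans (add_le_add (h.norm_le _ hz1) ?_)
    have h3 : ∀ k, ‖a (k + m) * ((r : ℂ) * z) ^ (k + m)‖ = ‖a (k + m) * (r : ℂ) ^ (k + m)‖ := by
      intro k
      simp [mul_pow, hz]
    refine (norm_tsum_le_tsum_norm ?_).trans (tsum_congr h3).le
    simp only [h3]
    exact (summable_nat_add_iff m).2 hs
  have hcoeff : ∀ m ≥ N, ∀ i ∈ Finset.range N,
      (P m * w).coeff i
        = ∑ x ∈ Finset.HasAntidiagonal.antidiagonal i, a x.1 * (r : ℂ) ^ x.1 * w.coeff x.2 := by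
    intro m hm i hi
    rw [coeff_mul]
    refine Finset.sum_congr rfl fun x hx => ?_
    have hx1 : x.1 < m := by
      have := Finset.HasAntidiagonal.mem_antidiagonal.1 hx
      have := Finset.mem_range.1 hi
      omega
    congr 1
    simp only [P, finsetSum_coeff, coeff_C_mul, coeff_X_pow]
    simp [hx1]
  have hlim : Filter.Tendsto (fun m => (1 + t m) ^ 2 * ∑ i ∈ w.support, ‖w.coeff i‖ ^ 2)
      Filter.atTop (nhds ((1 + 0) ^ 2 * ∑ i ∈ w.support, ‖w.coeff i‖ ^ 2)) :=
    ((ht.const_add 1).pow 2).mul_const _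
  rw [add_zero, one_pow, one_mul] at hlim
  refine ge_of_tendsto hlim (Filter.eventually_atTop.2 ⟨N, fun m hm => ?_⟩)
  refine le_trans (le_of_eq ?_) (Polynomial.sum_range_sq_norm_coeff_mul_le (P m) w (hP m) N)
  exact Finset.sum_congr rfl fun i hi => by rw [hcoeff m hm i hi]

/-- Multiplication by a function bounded by `1` is a contraction of the Hardy space `H²`. -/
theorem sum_sq_norm_antidiagonal_le (h : IsSchurSeries a g) (w : ℂ[X]) (N : ℕ) :
    ∑ i ∈ Finset.range N, ‖∑ x ∈ Finset.HasAntidiagonal.antidiagonal i, a x.1 * w.coeff x.2‖ ^ 2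
      ≤ ∑ i ∈ w.support, ‖w.coeff i‖ ^ 2 := by
  let F : ℝ → ℝ := fun r => ∑ i ∈ Finset.range N,
    ‖∑ x ∈ Finset.HasAntidiagonal.antidiagonal i, a x.1 * (r : ℂ) ^ x.1 * w.coeff x.2‖ ^ 2
  have hF : Continuous F := by fun_prop
  have hlim : Filter.Tendsto F (nhdsWithin 1 (Set.Iio 1)) (nhds (F 1)) :=
    hF.continuousWithinAt
  have hle : F 1 ≤ ∑ i ∈ w.support, ‖w.coeff i‖ ^ 2 := by
    refine le_of_tendsto hlim ?_
    filter_upwards [Ioo_mem_nhdsLT (zero_lt_one' ℝ)] with r hr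
    exact h.sum_sq_norm_antidiagonal_le_of_lt w N hr.1.le hr.2
  simpa [F] using hle

theorem sum_sq_norm_le_one (h : IsSchurSeries a g) (N : ℕ) :
    ∑ i ∈ Finset.range N, ‖a i‖ ^ 2 ≤ 1 := by
  have h1 := h.sum_sq_norm_antidiagonal_le 1 N
  have h2 : (1 : ℂ[X]).support = {0} := by
    simpa using Polynomial.support_C (R := ℂ) one_ne_zero
  rw [h2] at h1
  refine le_trans (le_of_eq (Finset.sum_congr rfl fun i _ => ?_)) (h1.trans (by simp))
  rw [Finset.Nat.sum_antidiagonal_eq_sum_range_succ fun k l => a k * (1 : ℂ[X]).coeff l,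
    Finset.sum_eq_single i]
  · simp
  · intro k hk hki
    have hk' := Finset.mem_range.1 hk
    rw [coeff_one, if_neg (by omega), mul_zero]
  · simp

/-- The upper triangular Toeplitz matrix built from the coefficients of a function bounded by `1`
is a contraction. -/
theorem sum_sq_norm_shift_le (h : IsSchurSeries a g) (n : ℕ) (y : ℕ → ℂ)
    (hy : ∀ j, n ≤ j → y j = 0) :
    ∑ i ∈ Finset.range n, ‖∑ k ∈ Finset.range n, a k * y (i + k)‖ ^ 2
      ≤ ∑ j ∈ Finset.range n, ‖y j‖ ^ 2 := by
  -- Reversing `y` turns the backward shifts into a Cauchy product: entry `i` is coefficient `n - 1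
  -- - i` of the product with `w`.
  let w : ℂ[X] := ∑ l ∈ Finset.range n, C (y (n - 1 - l)) * X ^ l
  have hw : ∀ l, w.coeff l = if l < n then y (n - 1 - l) else 0 := by
    intro l
    simp only [w, finsetSum_coeff, coeff_C_mul, coeff_X_pow]
    simp
  have h1 := h.sum_sq_norm_antidiagonal_le w n
  have h2 : ∑ i ∈ w.support, ‖w.coeff i‖ ^ 2 ≤ ∑ j ∈ Finset.range n, ‖y j‖ ^ 2 := by
    rw [← Finset.sum_range_reflect]
    have h3 : ∑ i ∈ w.support, ‖w.coeff i‖ ^ 2 ≤ ∑ i ∈ Finset.range n, ‖w.coeff i‖ ^ 2 := by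
      refine Finset.sum_le_sum_of_nonneg_of_ne_zero (fun _ => by positivity) fun i _ hi => ?_
      by_contra hi'
      rw [Finset.mem_range] at hi'
      simp [hw, hi'] at hi
    refine h3.trans (le_of_eq (Finset.sum_congr rfl fun i hi => ?_))
    rw [hw, if_pos (Finset.mem_range.1 hi)]
  refine le_trans (le_of_eq ?_) (h1.trans h2)
  rw [← Finset.sum_range_reflect]
  refine Finset.sum_congr rfl fun i hi => ?_
  have hi' := Finset.mem_range.1 hi
  rw [Finset.Nat.sum_antidiagonal_eq_sum_range_succ fun k l => a k * w.coeff l]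
  congr 2
  symm
  refine Finset.sum_subset_zero_on_sdiff (Finset.range_mono (by omega)) ?_ ?_
  · intro k hk
    simp only [Finset.mem_sdiff, Finset.mem_range] at hk
    rw [hy _ (by omega), mul_zero]
  · intro k hk
    have hk' := Finset.mem_range.1 hk
    rw [hw, if_pos (by omega)]
    congr 2
    omega

/-- A function bounded by `1` with a unimodular Taylor coefficient is a monomial. -/
theorem eq_monomial (h : IsSchurSeries a g) {m : ℕ} (hm : ‖a m‖ = 1) {z : ℂ} (hz : ‖z‖ < 1) :
    g z = a m * z ^ m := by
  have h0 : ∀ k, k ≠ m → a k = 0 := by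
    intro k hk
    have h1 := h.sum_sq_norm_le_one (k + m + 1)
    have h2 : ∑ i ∈ ({k, m} : Finset ℕ), ‖a i‖ ^ 2 ≤ ∑ i ∈ Finset.range (k + m + 1), ‖a i‖ ^ 2 := by
      refine Finset.sum_le_sum_of_subset_of_nonneg ?_ fun _ _ _ => by positivity
      intro i hi
      simp only [Finset.mem_insert, Finset.mem_singleton] at hi
      simp only [Finset.mem_range]
      omega
    rw [Finset.sum_pair hk, hm] at h2
    have h3 : ‖a k‖ ^ 2 = 0 := le_antisymm (by linarith) (by positivity)
    simpa using h3
  refine (h.hasSum z hz).unique (hasSum_single m fun k hk => ?_)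
  rw [h0 k hk, zero_mul]

end IsSchurSeries

/-! ### The weighted inequality and its equality case -/

/-- Conjugation by `diag(b^j)` gives the chain `‖L‖ ≤ ‖Z‖ ≤ ‖y‖ ≤ b^(n-1) ‖x‖`. In the equality case
each link is an equality, and the outer two hold termwise. -/
theorem IsSchurSeries.sum_sq_norm_weighted_le {a : ℕ → ℂ} {g : ℂ → ℂ} (h : IsSchurSeries a g)
    {n : ℕ} {b : ℝ} (hb : 1 ≤ b) {x : ℕ → ℂ} (hx : ∀ j, n ≤ j → x j = 0) :
    ∑ i ∈ Finset.range n, ‖∑ k ∈ Finset.range n, a k * (b : ℂ) ^ k * x (i + k)‖ ^ 2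
      ≤ (b ^ (n - 1)) ^ 2 * ∑ j ∈ Finset.range n, ‖x j‖ ^ 2 ∧
    (1 < b → (∃ j, x j ≠ 0) →
      ∑ i ∈ Finset.range n, ‖∑ k ∈ Finset.range n, a k * (b : ℂ) ^ k * x (i + k)‖ ^ 2
        = (b ^ (n - 1)) ^ 2 * ∑ j ∈ Finset.range n, ‖x j‖ ^ 2 → ‖a (n - 1)‖ = 1) := by
  have hb0 : 0 < b := by linarith
  have hnb : ‖(b : ℂ)‖ = b := by simp [abs_of_pos hb0]
  set y : ℕ → ℂ := fun j => (b : ℂ) ^ j * x j with hy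
  set L : ℕ → ℂ := fun i => ∑ k ∈ Finset.range n, a k * (b : ℂ) ^ k * x (i + k) with hL
  set Z : ℕ → ℂ := fun i => ∑ k ∈ Finset.range n, a k * y (i + k) with hZ
  have hZL : ∀ i, Z i = (b : ℂ) ^ i * L i := by
    intro i
    simp only [hZ, hL, hy, Finset.mul_sum]
    exact Finset.sum_congr rfl fun k _ => by ring
  have hyn : ∀ j, ‖y j‖ ^ 2 = (b ^ j) ^ 2 * ‖x j‖ ^ 2 := by
    intro j
    simp only [hy, norm_mul, norm_pow, hnb, mul_pow]
  have hZn : ∀ i, ‖Z i‖ ^ 2 = (b ^ i) ^ 2 * ‖L i‖ ^ 2 := by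
    intro i
    simp only [hZL, norm_mul, norm_pow, hnb, mul_pow]
  have h1 : ∀ i ∈ Finset.range n, ‖L i‖ ^ 2 ≤ ‖Z i‖ ^ 2 := by
    intro i _
    rw [hZn]
    exact le_mul_of_one_le_left (by positivity) (one_le_pow₀ (one_le_pow₀ hb))
  have h2 : ∑ i ∈ Finset.range n, ‖Z i‖ ^ 2 ≤ ∑ j ∈ Finset.range n, ‖y j‖ ^ 2 :=
    h.sum_sq_norm_shift_le n y fun j hj => by simp [hy, hx j hj]
  have h3 : ∀ j ∈ Finset.range n, ‖y j‖ ^ 2 ≤ (b ^ (n - 1)) ^ 2 * ‖x j‖ ^ 2 := by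
    intro j hj
    have := Finset.mem_range.1 hj
    rw [hyn]
    gcongr
    omega
  have h1s := Finset.sum_le_sum h1
  have h3s := Finset.sum_le_sum h3
  rw [← Finset.mul_sum] at h3s
  refine ⟨h1s.trans (h2.trans h3s), fun hb1 hx0 heq => ?_⟩
  have e1 := (Finset.sum_eq_sum_iff_of_le h1).1 (by linarith)
  have e3 := (Finset.sum_eq_sum_iff_of_le h3).1 (by rw [← Finset.mul_sum]; linarith)
  have e2 : ∑ i ∈ Finset.range n, ‖Z i‖ ^ 2 = ∑ j ∈ Finset.range n, ‖y j‖ ^ 2 := by linarith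
  -- The weight `b^j` is strictly below `b^(n-1)` except at the last index.
  have hxz : ∀ j, j ≠ n - 1 → x j = 0 := by
    intro j hj
    rcases le_or_gt n j with hjn | hjn
    · exact hx j hjn
    have e := e3 j (Finset.mem_range.2 hjn)
    rw [hyn] at e
    by_contra hne
    have hp : 0 < ‖x j‖ ^ 2 := by positivity
    have hlt : (b ^ j) ^ 2 < (b ^ (n - 1)) ^ 2 := by
      gcongr
      omega
    nlinarith
  have hyz : ∀ j, j ≠ n - 1 → y j = 0 := fun j hj => by simp [hy, hxz j hj]
  have hxn : x (n - 1) ≠ 0 := by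
    obtain ⟨j, hj⟩ := hx0
    by_cases hjn : j = n - 1
    · rwa [← hjn]
    · exact absurd (hxz j hjn) hj
  have hn : 0 < n := by
    by_contra hn
    exact hxn (hx _ (by omega))
  -- Dually, `b^i > 1` except at the first index, so only `Z 0` survives, and it contains the single
  -- term with `k = n - 1`.
  have hZz : ∀ i ∈ Finset.range n, i ≠ 0 → ‖Z i‖ ^ 2 = 0 := by
    intro i hi hi0
    have e := e1 i hi
    rw [hZn] at e ⊢
    have hlt : 1 < (b ^ i) ^ 2 := one_lt_pow₀ (one_lt_pow₀ hb1 hi0) two_ne_zero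
    have hp : 0 ≤ ‖L i‖ ^ 2 := by positivity
    nlinarith
  rw [Finset.sum_eq_single 0 hZz (fun h0 => absurd (Finset.mem_range.2 hn) h0),
    Finset.sum_eq_single (n - 1) (fun j _ hj => by simp [hyz j hj])
      (fun h0 => absurd (Finset.mem_range.2 (by omega)) h0)] at e2
  have hZ0 : Z 0 = a (n - 1) * y (n - 1) := by
    simp only [hZ, zero_add]
    exact Finset.sum_eq_single (n - 1) (fun j _ hj => by simp [hyz j hj])
      (fun h0 => absurd (Finset.mem_range.2 (by omega)) h0)
  have hyn0 : ‖y (n - 1)‖ ^ 2 ≠ 0 := by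
    rw [hyn]
    positivity
  rw [hZ0, norm_mul, mul_pow] at e2
  have e4 : ‖a (n - 1)‖ ^ 2 = 1 := mul_right_cancel₀ hyn0 (by rw [e2, one_mul])
  exact (pow_eq_one_iff_of_nonneg (norm_nonneg _) two_ne_zero).1 e4

/-! ### Powers of the Jordan block and operator norms -/

section JordanBlock

variable {n : ℕ}

theorem jordanBlock_mulVec {x : ℕ → ℂ} (hx : ∀ j, n ≤ j → x j = 0) :
    (jordanBlock n).mulVec (fun j => x j) = fun i : Fin n => x (i + 1) := by
  ext i
  simp only [Matrix.mulVec, dotProduct, jordanBlock, Matrix.of_apply, ite_mul, one_mul, zero_mul]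
  by_cases hi : (i : ℕ) + 1 < n
  · rw [Finset.sum_eq_single ⟨i + 1, hi⟩]
    · simp
    · intro j _ hj
      exact if_neg fun h => hj (Fin.ext h.symm)
    · simp
  · rw [hx _ (by omega)]
    exact Finset.sum_eq_zero fun j _ => if_neg fun h => by omega

theorem jordanBlock_pow_mulVec (k : ℕ) :
    ∀ {x : ℕ → ℂ}, (∀ j, n ≤ j → x j = 0) →
      (jordanBlock n ^ k).mulVec (fun j => x j) = fun i : Fin n => x (i + k) := by
  induction k with
  | zero => simp
  | succ k ih =>
    intro x hx
    rw [pow_succ, ← Matrix.mulVec_mulVec, jordanBlock_mulVec hx,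
      ih (x := fun j => x (j + 1)) fun j hj => hx _ (by omega)]
    simp only [add_assoc]

/-- With vectors extended by zero to all of `ℕ`, the Jordan block is a pure shift with no boundary
case. -/
theorem exists_extend_zero (v : Fin n → ℂ) :
    ∃ x : ℕ → ℂ, (∀ j, n ≤ j → x j = 0) ∧ v = fun j : Fin n => x j :=
  ⟨fun j => if h : j < n then v ⟨j, h⟩ else 0, fun j hj => dif_neg (by omega), by ext j; simp⟩

theorem jordanBlock_pow_self : jordanBlock n ^ n = 0 := by
  refine Matrix.mulVec_injective (funext fun v => ?_)
  obtain ⟨x, hx, rfl⟩ := exists_extend_zero v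
  rw [jordanBlock_pow_mulVec n hx, Matrix.zero_mulVec]
  ext i
  exact hx _ (by omega)

theorem sum_smul_jordanBlock_pow_mulVec (a : ℕ → ℂ) (s : ℂ) {x : ℕ → ℂ}
    (hx : ∀ j, n ≤ j → x j = 0) :
    (∑ k ∈ Finset.range n, a k • (s • jordanBlock n) ^ k).mulVec (fun j => x j)
      = fun i : Fin n => ∑ k ∈ Finset.range n, a k * s ^ k * x (i + k) := by
  rw [Matrix.sum_mulVec]
  ext i
  simp [_root_.smul_pow, Matrix.smul_mulVec, jordanBlock_pow_mulVec _ hx, mul_assoc]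

theorem sq_norm_toEuclideanCLM (M : Matrix (Fin n) (Fin n) ℂ) (v : EuclideanSpace ℂ (Fin n)) :
    ‖Matrix.toEuclideanCLM (n := Fin n) (𝕜 := ℂ) M v‖ ^ 2 = ∑ i, ‖M.mulVec v.ofLp i‖ ^ 2 := by
  rw [EuclideanSpace.norm_sq_eq, Matrix.ofLp_toEuclideanCLM]

/-- Compactness of the unit sphere. Attainment is what converts equality of norms into equality for
one vector. -/
theorem exists_norm_eq_one_norm_toEuclideanCLM_eq (hn : 0 < n) (M : Matrix (Fin n) (Fin n) ℂ) :
    ∃ v : EuclideanSpace ℂ (Fin n),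
      ‖v‖ = 1 ∧ ‖Matrix.toEuclideanCLM (n := Fin n) (𝕜 := ℂ) M v‖ = ‖M‖ := by
  set T := Matrix.toEuclideanCLM (n := Fin n) (𝕜 := ℂ) M with hT
  have : Nonempty (Fin n) := ⟨⟨0, hn⟩⟩
  obtain ⟨v, hv, hmax⟩ := (isCompact_sphere (0 : EuclideanSpace ℂ (Fin n)) 1).exists_isMaxOn
    (NormedSpace.sphere_nonempty.2 zero_le_one) (f := fun v => ‖T v‖) (by fun_prop)
  have hv1 : ‖v‖ = 1 := by simpa using hv
  refine ⟨v, hv1, le_antisymm ?_ ?_⟩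
  · have := T.le_opNorm v
    rwa [hv1, mul_one, Matrix.l2_opNorm_toEuclideanCLM] at this
  · rw [← Matrix.l2_opNorm_toEuclideanCLM]
    refine T.opNorm_le_bound (norm_nonneg _) fun w => ?_
    rcases eq_or_ne w 0 with rfl | hw
    · simp
    have hw' : ‖w‖ ≠ 0 := norm_ne_zero_iff.2 hw
    have h1 : ((‖w‖⁻¹ : ℝ) : ℂ) • w ∈ Metric.sphere (0 : EuclideanSpace ℂ (Fin n)) 1 := by
      simp [norm_smul, hw']
    have h2 : ‖T (((‖w‖⁻¹ : ℝ) : ℂ) • w)‖ ≤ ‖T v‖ := hmax h1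
    rw [map_smul, norm_smul, Complex.norm_real, norm_inv, norm_norm, inv_mul_le_iff₀ (by positivity)]
      at h2
    linarith

variable {a : ℕ → ℂ} {g : ℂ → ℂ} {b : ℝ}

theorem IsSchurSeries.norm_sum_smul_jordanBlock_pow_le (h : IsSchurSeries a g) (hb : 1 ≤ b) :
    ‖∑ k ∈ Finset.range n, a k • ((b : ℂ) • jordanBlock n) ^ k‖ ≤ b ^ (n - 1) := by
  have hb0 : 0 ≤ b ^ (n - 1) := by positivity
  rw [← Matrix.l2_opNorm_toEuclideanCLM]
  refine ContinuousLinearMap.opNorm_le_bound _ hb0 fun v => ?_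
  refine (pow_le_pow_iff_left₀ (norm_nonneg _) (by positivity) two_ne_zero).1 ?_
  obtain ⟨x, hx, hvx⟩ := exists_extend_zero v.ofLp
  rw [sq_norm_toEuclideanCLM, mul_pow, EuclideanSpace.norm_sq_eq, hvx,
    sum_smul_jordanBlock_pow_mulVec a _ hx]
  rw [Fin.sum_univ_eq_sum_range fun i => ‖∑ k ∈ Finset.range n, a k * (b : ℂ) ^ k * x (i + k)‖ ^ 2,
    Fin.sum_univ_eq_sum_range fun i => ‖x i‖ ^ 2]
  exact (h.sum_sq_norm_weighted_le hb hx).1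

theorem IsSchurSeries.eq_monomial_of_norm_eq (h : IsSchurSeries a g) (hn : 0 < n) (hb : 1 < b)
    (heq : ‖∑ k ∈ Finset.range n, a k • ((b : ℂ) • jordanBlock n) ^ k‖ = b ^ (n - 1)) :
    ∃ u : ℂ, ‖u‖ = 1 ∧ ∀ z : ℂ, ‖z‖ < 1 → g z = u * z ^ (n - 1) := by
  suffices h1 : ‖a (n - 1)‖ = 1 from ⟨a (n - 1), h1, fun z hz => h.eq_monomial h1 hz⟩
  obtain ⟨v, hv, hvn⟩ := exists_norm_eq_one_norm_toEuclideanCLM_eq hn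
    (∑ k ∈ Finset.range n, a k • ((b : ℂ) • jordanBlock n) ^ k)
  obtain ⟨x, hx, hvx⟩ := exists_extend_zero v.ofLp
  have e1 := congrArg (· ^ 2) hvn
  have e2 := congrArg (· ^ 2) hv
  simp only [heq, sq_norm_toEuclideanCLM] at e1
  simp only [EuclideanSpace.norm_sq_eq] at e2
  rw [hvx, sum_smul_jordanBlock_pow_mulVec a _ hx, Fin.sum_univ_eq_sum_range fun i =>
    ‖∑ k ∈ Finset.range n, a k * (b : ℂ) ^ k * x (i + k)‖ ^ 2] at e1
  rw [hvx, Fin.sum_univ_eq_sum_range fun i => ‖x i‖ ^ 2] at e2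
  refine (h.sum_sq_norm_weighted_le hb.le hx).2 hb ?_ (by rw [e1, e2]; ring)
  by_contra! h0
  simp [h0] at e2

theorem one_le_norm_jordanBlock_pow (hn : 0 < n) : 1 ≤ ‖jordanBlock n ^ (n - 1)‖ := by
  let x : ℕ → ℂ := fun j => if j = n - 1 then 1 else 0
  have hx : ∀ j, n ≤ j → x j = 0 := fun j hj => if_neg (by omega)
  let v : EuclideanSpace ℂ (Fin n) := WithLp.toLp 2 fun j => x j
  have hv : ‖v‖ ^ 2 = 1 := by
    rw [EuclideanSpace.norm_sq_eq]
    change ∑ i : Fin n, ‖x i‖ ^ 2 = 1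
    rw [Fin.sum_univ_eq_sum_range fun i => ‖x i‖ ^ 2, Finset.sum_eq_single (n - 1)]
    · simp [x]
    · intro j _ hj
      simp [x, hj]
    · intro h
      exact absurd (Finset.mem_range.2 (by omega)) h
  have hv1 : ‖v‖ = 1 := (pow_eq_one_iff_of_nonneg (norm_nonneg _) two_ne_zero).1 hv
  have h1 := (Matrix.toEuclideanCLM (n := Fin n) (𝕜 := ℂ) (jordanBlock n ^ (n - 1))).le_opNorm v
  rw [hv1, mul_one, Matrix.l2_opNorm_toEuclideanCLM] at h1
  refine le_trans ?_ h1
  refine le_trans (le_of_eq ?_) (PiLp.norm_apply_le _ (⟨0, hn⟩ : Fin n))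
  rw [Matrix.ofLp_toEuclideanCLM, jordanBlock_pow_mulVec (n - 1) hx]
  simp [x]

end JordanBlock

/-! ### Functions of a scaled Jordan block -/

section MatrixFun

theorem Polynomial.iteratedDeriv_eval (p : ℂ[X]) (k : ℕ) :
    iteratedDeriv k (fun z => p.eval z) = fun z => (derivative^[k] p).eval z := by
  induction k with
  | zero => simp
  | succ k ih =>
    rw [iteratedDeriv_succ, ih, Function.iterate_succ_apply']
    ext z
    exact Polynomial.deriv _

variable {n : ℕ}

theorem eq_zero_of_mem_spectrum_smul_jordanBlock {s z : ℂ}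
    (hz : z ∈ spectrum ℂ (s • jordanBlock n)) : z = 0 := by
  by_contra h0
  refine hz ?_
  have hnil : IsNilpotent (-(s • jordanBlock n)) :=
    IsNilpotent.neg ⟨n, by rw [_root_.smul_pow, jordanBlock_pow_self, smul_zero]⟩
  have hu : IsUnit (algebraMap ℂ (Matrix (Fin n) (Fin n) ℂ) z) := (Ne.isUnit h0).map _
  have := hnil.isUnit_add_left_of_commute hu (Algebra.commutes _ _).symm
  simpa [resolventSet, sub_eq_add_neg] using this

theorem matrixFun_smul_jordanBlock_of_eventuallyEq {f : ℂ → ℂ} {p : ℂ[X]} {s : ℂ}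
    (h : f =ᶠ[nhds 0] fun z => p.eval z) :
    matrixFun f (s • jordanBlock n) = aeval (s • jordanBlock n) p := by
  refine matrixFun_eq_aeval fun z hz k _ => ?_
  rw [eq_zero_of_mem_spectrum_smul_jordanBlock hz, h.iteratedDeriv_eq k,
    Polynomial.iteratedDeriv_eval]

/-- The only possible eigenvalue is 0, so the Taylor polynomial at 0 with `n` terms is a Hermite
interpolant. -/
theorem matrixFun_smul_jordanBlock (f : ℂ → ℂ) (s : ℂ) :
    matrixFun f (s • jordanBlock n)
      = ∑ k ∈ Finset.range n,
          ((k.factorial : ℂ)⁻¹ * iteratedDeriv k f 0) • (s • jordanBlock n) ^ k := by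
  rw [matrixFun_eq_aeval (p := ∑ k ∈ Finset.range n,
    C ((k.factorial : ℂ)⁻¹ * iteratedDeriv k f 0) * X ^ k)]
  · simp [Algebra.smul_def]
  · intro z hz k hk
    have h0 : (k.factorial : ℂ) ≠ 0 := Nat.cast_ne_zero.2 k.factorial_ne_zero
    rw [eq_zero_of_mem_spectrum_smul_jordanBlock hz, ← coeff_zero_eq_eval_zero,
      coeff_iterate_derivative]
    simp only [finsetSum_coeff, coeff_C_mul, coeff_X_pow, zero_add]
    simp [hk, Nat.descFactorial_self, h0]

theorem isSchurSeries_taylor {f : ℂ → ℂ} {ρ : ℝ} (hρ : 0 < ρ)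
    (hf : DifferentiableOn ℂ f (Metric.ball 0 ρ)) (hf1 : ∀ z ∈ Metric.ball (0 : ℂ) ρ, ‖f z‖ ≤ 1) :
    IsSchurSeries (fun k => (k.factorial : ℂ)⁻¹ * iteratedDeriv k f 0 * (ρ : ℂ) ^ k)
      (fun z => f (ρ * z)) := by
  have hmem : ∀ z : ℂ, ‖z‖ < 1 → (ρ : ℂ) * z ∈ Metric.ball (0 : ℂ) ρ := by
    intro z hz
    rw [mem_ball_zero_iff, norm_mul, Complex.norm_real, Real.norm_of_nonneg hρ.le]
    exact mul_lt_of_lt_one_right hρ hz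
  refine ⟨fun z hz => ?_, fun z hz => hf1 _ (hmem z hz)⟩
  have h := Complex.hasSum_taylorSeries_on_ball hf (hmem z hz)
  convert! h using 2 with k
  simp only [smul_eq_mul, sub_zero]
  ring

variable {f : ℂ → ℂ} {ρ b : ℝ}

/-- Splitting the scale as `ρ * b` covers both uses: `ρ = cos(π/(n+1))`, `b = 1/ρ` gives `f(J)`,
while `ρ = 1`, `b = sec(π/(n+1))` gives `B(φ(J))`. -/
theorem matrixFun_mul_smul_jordanBlock (f : ℂ → ℂ) (ρ b : ℝ) :
    matrixFun f (((ρ * b : ℝ) : ℂ) • jordanBlock n)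
      = ∑ k ∈ Finset.range n, ((k.factorial : ℂ)⁻¹ * iteratedDeriv k f 0 * (ρ : ℂ) ^ k) •
          ((b : ℂ) • jordanBlock n) ^ k := by
  rw [matrixFun_smul_jordanBlock]
  refine Finset.sum_congr rfl fun k _ => ?_
  rw [_root_.smul_pow, _root_.smul_pow, smul_smul, smul_smul]
  congr 1
  push_cast
  ring

theorem norm_matrixFun_smul_jordanBlock_le (hρ : 0 < ρ) (hb : 1 ≤ b)
    (hf : DifferentiableOn ℂ f (Metric.ball 0 ρ)) (hf1 : ∀ z ∈ Metric.ball (0 : ℂ) ρ, ‖f z‖ ≤ 1) :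
    ‖matrixFun f (((ρ * b : ℝ) : ℂ) • jordanBlock n)‖ ≤ b ^ (n - 1) := by
  rw [matrixFun_mul_smul_jordanBlock]
  exact (isSchurSeries_taylor hρ hf hf1).norm_sum_smul_jordanBlock_pow_le hb

theorem norm_matrixFun_smul_jordanBlock_eq_iff (hn : 0 < n) (hρ : 0 < ρ) (hb : 1 < b)
    (hf : DifferentiableOn ℂ f (Metric.ball 0 ρ)) (hf1 : ∀ z ∈ Metric.ball (0 : ℂ) ρ, ‖f z‖ ≤ 1) :
    ‖matrixFun f (((ρ * b : ℝ) : ℂ) • jordanBlock n)‖ = b ^ (n - 1) ↔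
      ∃ u : ℂ, ‖u‖ = 1 ∧ ∀ z ∈ Metric.ball (0 : ℂ) ρ, f z = u * (z / ρ) ^ (n - 1) := by
  have hρ' : (ρ : ℂ) ≠ 0 := Complex.ofReal_ne_zero.2 hρ.ne'
  constructor
  · intro h
    rw [matrixFun_mul_smul_jordanBlock] at h
    obtain ⟨u, hu, hfu⟩ := (isSchurSeries_taylor hρ hf hf1).eq_monomial_of_norm_eq hn hb h
    refine ⟨u, hu, fun z hz => ?_⟩
    rw [mem_ball_zero_iff] at hz
    have := hfu (z / ρ) (by
      rw [norm_div, Complex.norm_real, Real.norm_of_nonneg hρ.le]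
      exact (div_lt_one hρ).2 hz)
    rwa [mul_div_cancel₀ _ hρ'] at this
  · rintro ⟨u, hu, hfu⟩
    refine le_antisymm (norm_matrixFun_smul_jordanBlock_le hρ hb.le hf hf1) ?_
    rw [matrixFun_smul_jordanBlock_of_eventuallyEq
      (p := C (u / (ρ : ℂ) ^ (n - 1)) * X ^ (n - 1))]
    · have hnρ : ‖(ρ : ℂ) ^ (n - 1)‖ ≠ 0 := by simp [hρ.ne']
      rw [map_mul, aeval_C, map_pow, aeval_X, ← Algebra.smul_def, _root_.smul_pow, smul_smul,
        norm_smul]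
      have h1 : ‖u / (ρ : ℂ) ^ (n - 1) * ((ρ * b : ℝ) : ℂ) ^ (n - 1)‖ = b ^ (n - 1) := by
        rw [Complex.ofReal_mul, mul_pow, div_mul_eq_mul_div, mul_left_comm, mul_div_cancel_left₀ _
          (pow_ne_zero _ hρ'), norm_mul, hu, one_mul, norm_pow, Complex.norm_real,
          Real.norm_of_nonneg (by linarith)]
      rw [h1]
      exact le_mul_of_one_le_right (by positivity) (one_le_norm_jordanBlock_pow hn)
    · filter_upwards [Metric.ball_mem_nhds (0 : ℂ) hρ] with z hz
      rw [hfu z hz]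
      simp only [eval_mul, eval_C, eval_pow, eval_X, div_pow]
      ring

end MatrixFun

/-! ### Blaschke products on the closed disk -/

section Blaschke

theorem one_sub_star_mul_ne_zero {α z : ℂ} (hα : ‖α‖ < 1) (hz : ‖z‖ ≤ 1) : 1 - star α * z ≠ 0 := by
  intro h
  have h1 : ‖star α * z‖ = 1 := by rw [← sub_eq_zero.1 h, norm_one]
  rw [norm_mul, norm_star] at h1
  nlinarith [norm_nonneg α, norm_nonneg z]

/-- The difference of the squares is `(1 - |α|²)(1 - |z|²) ≥ 0`. -/
theorem norm_sub_le_norm_one_sub_star_mul {α z : ℂ} (hα : ‖α‖ ≤ 1) (hz : ‖z‖ ≤ 1) :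
    ‖z - α‖ ≤ ‖1 - star α * z‖ := by
  refine (pow_le_pow_iff_left₀ (norm_nonneg _) (norm_nonneg _) two_ne_zero).1 ?_
  have h1 : ‖α‖ ^ 2 ≤ 1 := pow_le_one₀ (norm_nonneg _) hα
  have h2 : ‖z‖ ^ 2 ≤ 1 := pow_le_one₀ (norm_nonneg _) hz
  rw [← Complex.normSq_eq_norm_sq, Complex.normSq_apply] at h1 h2 ⊢
  rw [← Complex.normSq_eq_norm_sq, Complex.normSq_apply]
  simp only [Complex.sub_re, Complex.sub_im, Complex.mul_re, Complex.mul_im, Complex.one_re,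
    Complex.one_im, Complex.star_def, Complex.conj_re, Complex.conj_im]
  nlinarith [mul_nonneg (sub_nonneg.2 h1) (sub_nonneg.2 h2)]

theorem norm_div_one_sub_star_mul_le_one {α z : ℂ} (hα : ‖α‖ < 1) (hz : ‖z‖ ≤ 1) :
    ‖(z - α) / (1 - star α * z)‖ ≤ 1 := by
  rw [norm_div]
  exact div_le_one_of_le₀ (norm_sub_le_norm_one_sub_star_mul hα.le hz) (norm_nonneg _)

variable {m : ℕ} {B : ℂ → ℂ}

theorem IsBlaschkeProduct.norm_le_one (h : IsBlaschkeProduct m B) {z : ℂ} (hz : ‖z‖ ≤ 1) :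
    ‖B z‖ ≤ 1 := by
  obtain ⟨γ, α, hα, hB⟩ := h
  rw [hB z (by simpa using hz), norm_mul, mul_comm Complex.I, Complex.norm_exp_ofReal_mul_I,
    one_mul, norm_prod]
  exact Finset.prod_le_one (fun _ _ => norm_nonneg _) fun j _ =>
    norm_div_one_sub_star_mul_le_one (hα j) hz

theorem IsBlaschkeProduct.continuousOn (h : IsBlaschkeProduct m B) :
    ContinuousOn B (Metric.closedBall 0 1) := by
  obtain ⟨γ, α, hα, hB⟩ := h
  refine ContinuousOn.congr ?_ hB
  refine continuousOn_const.mul (continuousOn_finsetProd _ fun j _ => ?_)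
  refine ContinuousOn.div (by fun_prop) (by fun_prop) fun z hz => ?_
  exact one_sub_star_mul_ne_zero (hα j) (by simpa using hz)

theorem IsBlaschkeProduct.differentiableOn (h : IsBlaschkeProduct m B) :
    DifferentiableOn ℂ B (Metric.ball 0 1) := by
  obtain ⟨γ, α, hα, hB⟩ := h
  refine DifferentiableOn.congr ?_ fun z hz => hB z (Metric.ball_subset_closedBall hz)
  refine (differentiableOn_const _).mul (DifferentiableOn.fun_finsetProd fun j _ => ?_)
  refine DifferentiableOn.div (by fun_prop) (by fun_prop) fun z hz => ?_
  exact one_sub_star_mul_ne_zero (hα j) (by simpa using (Metric.ball_subset_closedBall hz))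

theorem isBlaschkeProduct_pow (m : ℕ) : IsBlaschkeProduct m fun z => z ^ m :=
  ⟨0, fun _ => 0, by simp, by simp⟩

end Blaschke

/-! ### The numerical range of the Jordan block -/

section NumericalRange

variable {n : ℕ}

theorem mem_numericalRange_jordanBlock {z : ℂ} :
    z ∈ numericalRange (jordanBlock n) ↔
      ∃ x : ℕ → ℂ, (∀ j, n ≤ j → x j = 0) ∧ ∑ j ∈ Finset.range n, ‖x j‖ ^ 2 = 1 ∧
        z = ∑ j ∈ Finset.range n, star (x j) * x (j + 1) := by
  have hform : ∀ x : ℕ → ℂ, (∀ j, n ≤ j → x j = 0) →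
      star (fun j : Fin n => x j) ⬝ᵥ (jordanBlock n).mulVec (fun j => x j)
        = ∑ j ∈ Finset.range n, star (x j) * x (j + 1) := by
    intro x hx
    rw [jordanBlock_mulVec hx, ← Fin.sum_univ_eq_sum_range fun j => star (x j) * x (j + 1)]
    rfl
  constructor
  · rintro ⟨q, hq, rfl⟩
    obtain ⟨x, hx, hqx⟩ := exists_extend_zero q.ofLp
    refine ⟨x, hx, ?_, by rw [hqx, hform x hx]⟩
    have h := congrArg (· ^ 2) hq
    simp only [EuclideanSpace.norm_sq_eq, hqx] at h
    rwa [Fin.sum_univ_eq_sum_range fun j => ‖x j‖ ^ 2, one_pow] at h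
  · rintro ⟨x, hx, hx1, rfl⟩
    refine ⟨WithLp.toLp 2 fun j => x j, ?_, (hform x hx).symm⟩
    refine (pow_eq_one_iff_of_nonneg (norm_nonneg _) two_ne_zero).1 ?_
    rw [EuclideanSpace.norm_sq_eq, ← hx1, ← Fin.sum_univ_eq_sum_range fun j => ‖x j‖ ^ 2]

theorem Real.sin_nat_mul_add_sin_nat_add_two_mul (θ : ℝ) (k : ℕ) :
    Real.sin (k * θ) + Real.sin ((k + 2 : ℕ) * θ)
      = 2 * Real.cos θ * Real.sin ((k + 1 : ℕ) * θ) := by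
  have h1 : (k : ℝ) * θ = (k + 1 : ℕ) * θ - θ := by push_cast; ring
  have h2 : ((k + 2 : ℕ) : ℝ) * θ = (k + 1 : ℕ) * θ + θ := by push_cast; ring
  rw [h1, h2, Real.sin_sub, Real.sin_add]
  ring

theorem sin_nat_mul_pi_div_pos {k : ℕ} (hk : 0 < k) (hkn : k < n + 1) :
    0 < Real.sin (k * (Real.pi / (n + 1))) := by
  have hk' : (0 : ℝ) < k := by exact_mod_cast hk
  have hkn' : (k : ℝ) < n + 1 := by exact_mod_cast hkn
  refine Real.sin_pos_of_pos_of_lt_pi (by positivity) ?_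
  rw [mul_div_assoc', div_lt_iff₀ (by positivity), mul_comm]
  exact mul_lt_mul_of_pos_left hkn' Real.pi_pos

theorem sin_succ_mul_pi_div_eq_zero : Real.sin ((n + 1 : ℕ) * (Real.pi / (n + 1))) = 0 := by
  have h : ((n + 1 : ℕ) : ℝ) * (Real.pi / (n + 1)) = Real.pi := by
    push_cast
    field_simp
  rw [h, Real.sin_pi]

/-- Each product `2 r_k r_(k+1)` is split by AM-GM with weights `t_(k+2)/t_(k+1)` and its inverse,
where `t_k = sin(kθ)`. The sine recurrence makes the two contributions to each `r_k²` add up to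
exactly `2 cos θ`. -/
theorem sum_mul_succ_le (n : ℕ) {r : ℕ → ℝ} (hr : ∀ j, n ≤ j → r j = 0) :
    ∑ i ∈ Finset.range n, r i * r (i + 1)
      ≤ Real.cos (Real.pi / (n + 1)) * ∑ i ∈ Finset.range n, r i ^ 2 := by
  cases n with
  | zero => simp
  | succ m =>
    set θ : ℝ := Real.pi / ((m + 1 : ℕ) + 1) with hθ
    set t : ℕ → ℝ := fun k => Real.sin (k * θ) with ht
    have hpos : ∀ k, 0 < k → k < m + 2 → 0 < t k := fun k h1 h2 =>
      sin_nat_mul_pi_div_pos (n := m + 1) h1 h2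
    have hrec : ∀ k, t k + t (k + 2) = 2 * Real.cos θ * t (k + 1) :=
      Real.sin_nat_mul_add_sin_nat_add_two_mul θ
    have hend : t (m + 2) = 0 := sin_succ_mul_pi_div_eq_zero (n := m + 1)
    have key : ∀ k ≤ m, 2 * ∑ i ∈ Finset.range k, r i * r (i + 1)
        ≤ 2 * Real.cos θ * ∑ i ∈ Finset.range k, r i ^ 2 + t k / t (k + 1) * r k ^ 2 := by
      intro k
      induction k with
      | zero => simp [ht]
      | succ k ih =>
        intro hk
        have ih' := ih (by omega)
        have p1 := hpos (k + 1) (by omega) (by omega)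
        have p2 := hpos (k + 2) (by omega) (by omega)
        have e1 : 2 * Real.cos θ - t k / t (k + 1) = t (k + 2) / t (k + 1) := by
          rw [eq_div_iff p1.ne', sub_mul, div_mul_cancel₀ _ p1.ne', ← hrec k]
          ring
        have e2 : 2 * (r k * r (k + 1))
            ≤ t (k + 2) / t (k + 1) * r k ^ 2 + t (k + 1) / t (k + 2) * r (k + 1) ^ 2 := by
          have e3 : t (k + 2) / t (k + 1) * r k ^ 2 + t (k + 1) / t (k + 2) * r (k + 1) ^ 2
              - 2 * (r k * r (k + 1))
              = (t (k + 2) * r k - t (k + 1) * r (k + 1)) ^ 2 / (t (k + 1) * t (k + 2)) := by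
            field_simp
            ring
          have e4 : 0 ≤ (t (k + 2) * r k - t (k + 1) * r (k + 1)) ^ 2 / (t (k + 1) * t (k + 2)) := by
            positivity
          linarith
        rw [Finset.sum_range_succ, Finset.sum_range_succ]
        rw [← e1] at e2
        linarith
    have hm := key m le_rfl
    have p := hpos (m + 1) (by omega) (by omega)
    -- Since `t (m + 2) = 0`, the leftover weight on the last square is again `2 cos θ`.
    have e : t m / t (m + 1) = 2 * Real.cos θ := by
      rw [div_eq_iff p.ne', ← hrec m, hend, add_zero]
    rw [e] at hm
    rw [Finset.sum_range_succ, Finset.sum_range_succ, hr (m + 1) le_rfl]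
    linarith

/-- Intermediate values of the quadratic form along the segment from the first basis vector, where
it is 0, to the sine vector, where its Rayleigh quotient is `cos θ`. Normalization is postponed to
the end. -/
theorem exists_sum_sq_eq_one_sum_mul_succ_eq (hn : 0 < n) {ρ : ℝ} (h0 : 0 ≤ ρ)
    (h1 : ρ ≤ Real.cos (Real.pi / (n + 1))) :
    ∃ r : ℕ → ℝ, (∀ j, n ≤ j → r j = 0) ∧ ∑ i ∈ Finset.range n, r i ^ 2 = 1 ∧
      ∑ i ∈ Finset.range n, r i * r (i + 1) = ρ := by
  set θ : ℝ := Real.pi / (n + 1) with hθ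
  set t : ℕ → ℝ := fun k => Real.sin (k * θ) with ht
  have hend : t (n + 1) = 0 := sin_succ_mul_pi_div_eq_zero (n := n)
  have htp : 0 < t 1 := sin_nat_mul_pi_div_pos one_pos (by omega)
  let e : ℕ → ℝ := fun j => if j = 0 then 1 else 0
  let s : ℕ → ℝ := fun j => if j < n then t (j + 1) else 0
  have hs : ∀ j ≤ n, s j = t (j + 1) := by
    intro j hj
    rcases hj.lt_or_eq with h | rfl
    · exact if_pos h
    · rw [hend]
      exact if_neg (lt_irrefl _)
  let x : ℝ → ℕ → ℝ := fun τ j => (1 - τ) * e j + τ * s j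
  have hx : ∀ τ j, n ≤ j → x τ j = 0 := by
    intro τ j hj
    simp [x, e, s, hj.not_gt, (hn.trans_le hj).ne']
  let G : ℝ → ℝ := fun τ =>
    ∑ i ∈ Finset.range n, x τ i * x τ (i + 1) - ρ * ∑ i ∈ Finset.range n, x τ i ^ 2
  have hG : Continuous G := by fun_prop
  have hG0 : G 0 ≤ 0 := by
    have : ∑ i ∈ Finset.range n, x 0 i * x 0 (i + 1) = 0 :=
      Finset.sum_eq_zero fun i _ => by simp [x, e]
    simp only [G, this, zero_sub, Left.neg_nonpos_iff]
    exact mul_nonneg h0 (Finset.sum_nonneg fun _ _ => sq_nonneg _)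
  have hG1 : 0 ≤ G 1 := by
    have hsum : ∑ i ∈ Finset.range n, s i * s (i + 1)
        = Real.cos θ * ∑ i ∈ Finset.range n, s i ^ 2 := by
      have a1 : ∑ i ∈ Finset.range n, s i * s (i + 1)
          = ∑ i ∈ Finset.range n, t (i + 1) * t (i + 2) := by
        refine Finset.sum_congr rfl fun i hi => ?_
        have := Finset.mem_range.1 hi
        rw [hs i (by omega), hs (i + 1) (by omega)]
      have a2 : ∑ i ∈ Finset.range n, s i ^ 2 = ∑ i ∈ Finset.range n, t (i + 1) ^ 2 := by
        refine Finset.sum_congr rfl fun i hi => ?_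
        rw [hs i (Finset.mem_range.1 hi).le]
      have a3 : ∑ i ∈ Finset.range n, (t (i + 1) * t (i + 2) - t i * t (i + 1)) = 0 := by
        rw [Finset.sum_range_sub fun i => t i * t (i + 1), hend]
        simp [ht]
      have a4 : ∑ i ∈ Finset.range n, (t (i + 1) * t (i + 2) + t i * t (i + 1))
          = 2 * Real.cos θ * ∑ i ∈ Finset.range n, t (i + 1) ^ 2 := by
        rw [Finset.mul_sum]
        refine Finset.sum_congr rfl fun i _ => ?_
        have := Real.sin_nat_mul_add_sin_nat_add_two_mul θ i
        change t i + t (i + 2) = 2 * Real.cos θ * t (i + 1) at this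
        linear_combination t (i + 1) * this
      rw [a1, a2]
      rw [Finset.sum_sub_distrib] at a3
      rw [Finset.sum_add_distrib] at a4
      linarith
    have hx1 : x 1 = s := by
      ext j
      simp [x]
    simp only [G, hx1, hsum, ← sub_mul]
    exact mul_nonneg (sub_nonneg.2 h1) (Finset.sum_nonneg fun _ _ => sq_nonneg _)
  obtain ⟨τ, hτ, hGτ⟩ := intermediate_value_Icc zero_le_one hG.continuousOn ⟨hG0, hG1⟩
  -- Both endpoints have positive first coordinate, so the segment avoids 0 and the vector can be
  -- normalized.
  have hx0 : 0 < x τ 0 := by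
    have : x τ 0 = (1 - τ) + τ * t 1 := by simp [x, e, s, hn]
    rw [this]
    rcases hτ.1.eq_or_lt with h | h
    · simp [← h]
    · have := mul_pos h htp
      linarith [hτ.2]
  set S := ∑ i ∈ Finset.range n, x τ i ^ 2 with hS
  have hSpos : 0 < S := Finset.sum_pos' (fun _ _ => sq_nonneg _)
    ⟨0, Finset.mem_range.2 hn, pow_pos hx0 2⟩
  have hsq : Real.sqrt S * Real.sqrt S = S := Real.mul_self_sqrt hSpos.le
  refine ⟨fun j => x τ j / Real.sqrt S, fun j hj => by simp [hx τ j hj], ?_, ?_⟩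
  · simp only [div_pow, ← Finset.sum_div]
    rw [Real.sq_sqrt hSpos.le, ← hS, div_self hSpos.ne']
  · simp only [div_mul_div_comm, ← Finset.sum_div, hsq]
    rw [div_eq_iff hSpos.ne']
    exact sub_eq_zero.1 hGτ

theorem numericalRange_jordanBlock (hn : 0 < n) :
    numericalRange (jordanBlock n) = Metric.closedBall 0 (Real.cos (Real.pi / (n + 1))) := by
  ext z
  rw [mem_numericalRange_jordanBlock, mem_closedBall_zero_iff]
  constructor
  · rintro ⟨x, hx, hx1, rfl⟩
    have h := sum_mul_succ_le n (r := fun j => ‖x j‖) fun j hj => by simp [hx j hj]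
    rw [hx1, mul_one] at h
    refine (norm_sum_le _ _).trans (le_trans (le_of_eq ?_) h)
    simp
  · intro hz
    obtain ⟨r, hr, hr1, hrz⟩ := exists_sum_sq_eq_one_sum_mul_succ_eq hn (norm_nonneg z) hz
    -- Phases `ω^j` keep the norm and multiply every term of the form by `ω`.
    set ω : ℂ := Complex.exp (z.arg * Complex.I) with hω
    have hω1 : ‖ω‖ = 1 := Complex.norm_exp_ofReal_mul_I _
    have hωs : star ω * ω = 1 := by
      rw [Complex.star_def, Complex.conj_mul', hω1]
      simp
    refine ⟨fun j => r j * ω ^ j, fun j hj => by simp [hr j hj], ?_, ?_⟩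
    · simpa [hω1] using hr1
    · have hterm : ∀ j, star ((r j : ℂ) * ω ^ j) * (r (j + 1) * ω ^ (j + 1))
          = ((r j * r (j + 1) : ℝ) : ℂ) * ω := by
        intro j
        have e1 : star ω ^ j * ω ^ j = 1 := by rw [← mul_pow, hωs, one_pow]
        rw [star_mul', star_pow, Complex.star_def, Complex.conj_ofReal, ← Complex.star_def]
        push_cast
        linear_combination (r j : ℂ) * r (j + 1) * ω * e1
      simp only [hterm]
      rw [← Finset.sum_mul, ← Complex.ofReal_sum, hrz, Complex.norm_mul_exp_arg_mul_I]

end NumericalRange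

/-! ### The scaling map and the sup norm of monomials -/

theorem cos_pi_div_succ_pos {n : ℕ} (hn : 2 ≤ n) : 0 < Real.cos (Real.pi / (n + 1)) := by
  have hn' : (2 : ℝ) ≤ n := by exact_mod_cast hn
  have hp := Real.pi_pos
  refine Real.cos_pos_of_mem_Ioo ⟨?_, ?_⟩
  · have : 0 < Real.pi / (n + 1) := by positivity
    linarith
  · exact div_lt_div_of_pos_left hp two_pos (by linarith)

theorem cos_pi_div_succ_lt_one (n : ℕ) : Real.cos (Real.pi / (n + 1)) < 1 := by
  have hp := Real.pi_pos
  have h : Real.cos (Real.pi / (n + 1)) < Real.cos 0 := by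
    refine Real.cos_lt_cos_of_nonneg_of_le_pi le_rfl ?_ (by positivity)
    exact div_le_self hp.le (by linarith [(Nat.cast_nonneg n : (0 : ℝ) ≤ n)])
  rwa [Real.cos_zero] at h

theorem isConformalOntoDisk_div {c : ℝ} (hc : 0 < c) :
    IsConformalOntoDisk (Metric.closedBall 0 c) fun z => z / (c : ℂ) := by
  have hc' : (c : ℂ) ≠ 0 := Complex.ofReal_ne_zero.2 hc.ne'
  have hnc : ‖(c : ℂ)‖ = c := by rw [Complex.norm_real, Real.norm_of_nonneg hc.le]
  rw [IsConformalOntoDisk, interior_closedBall _ hc.ne']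
  have hinj : ∀ s : Set ℂ, Set.InjOn (fun z => z / (c : ℂ)) s :=
    fun s => fun z _ w _ h => (div_left_inj' hc').1 h
  refine ⟨by fun_prop, ⟨fun z hz => ?_, hinj _, fun w hw => ⟨w * c, ?_, ?_⟩⟩, by fun_prop,
    ⟨fun z hz => ?_, hinj _, fun w hw => ⟨w * c, ?_, ?_⟩⟩⟩
  · rw [mem_ball_zero_iff] at hz ⊢
    rwa [norm_div, hnc, div_lt_one hc]
  · rw [mem_ball_zero_iff] at hw ⊢
    rw [norm_mul, hnc]
    exact mul_lt_of_lt_one_left hc hw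
  · exact mul_div_cancel_right₀ _ hc'
  · rw [mem_closedBall_zero_iff] at hz ⊢
    rwa [norm_div, hnc, div_le_one hc]
  · rw [mem_closedBall_zero_iff] at hw ⊢
    rw [norm_mul, hnc]
    exact mul_le_of_le_one_left hc.le hw
  · exact mul_div_cancel_right₀ _ hc'

theorem matrixFun_jordanConformal (n : ℕ) :
    matrixFun (jordanConformal n) (jordanBlock n)
      = ((1 / Real.cos (Real.pi / (n + 1)) : ℝ) : ℂ) • jordanBlock n := by
  have h := matrixFun_smul_jordanBlock_of_eventuallyEq (n := n) (f := jordanConformal n) (s := 1)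
    (p := C ((1 / Real.cos (Real.pi / (n + 1)) : ℝ) : ℂ) * X) (Filter.Eventually.of_forall fun z => by
      simp [jordanConformal, div_eq_inv_mul])
  rw [one_smul] at h
  rw [h, map_mul, aeval_C, aeval_X, ← Algebra.smul_def]

/-- The constant `1` is the least upper bound of the moduli of `z ↦ (z / c) ^ m` on the open disk of
radius `c`. -/
theorem isLUB_norm_monomial {c : ℝ} (hc : 0 < c) (m : ℕ) {u : ℂ} (hu : ‖u‖ = 1) {f : ℂ → ℂ}
    (hf : ∀ z ∈ Metric.ball (0 : ℂ) c, f z = u * (z / c) ^ m) :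
    IsLUB ((fun z => ‖f z‖) '' Metric.ball 0 c) 1 := by
  have hnf : ∀ z ∈ Metric.ball (0 : ℂ) c, ‖f z‖ = (‖z‖ / c) ^ m := by
    intro z hz
    rw [hf z hz, norm_mul, hu, one_mul, norm_pow, norm_div, Complex.norm_real,
      Real.norm_of_nonneg hc.le]
  refine ⟨?_, fun M hM => ?_⟩
  · rintro _ ⟨z, hz, rfl⟩
    simp only [hnf z hz]
    rw [mem_ball_zero_iff] at hz
    exact pow_le_one₀ (by positivity) ((div_le_one hc).2 hz.le)
  · have hlim : Filter.Tendsto (fun t : ℝ => t ^ m) (nhdsWithin 1 (Set.Iio 1)) (nhds (1 ^ m)) :=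
      (continuous_pow m).continuousWithinAt
    rw [one_pow] at hlim
    refine le_of_tendsto hlim ?_
    filter_upwards [Ioo_mem_nhdsLT (zero_lt_one' ℝ)] with t ht
    have hn : ‖((t * c : ℝ) : ℂ)‖ = t * c := by
      rw [Complex.norm_real, Real.norm_of_nonneg (mul_nonneg ht.1.le hc.le)]
    have hmem : ((t * c : ℝ) : ℂ) ∈ Metric.ball (0 : ℂ) c := by
      rw [mem_ball_zero_iff, hn]
      exact mul_lt_of_lt_one_left hc ht.2
    have h := hM ⟨_, hmem, rfl⟩
    simp only [hnf _ hmem, hn] at h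
    rwa [mul_div_cancel_right₀ _ hc.ne'] at h

/-! ### Extremality and uniqueness -/

section Extremal

variable {n : ℕ} {f : ℂ → ℂ}

theorem isUnitHInfty_numericalRange_jordanBlock_iff (hn : 2 ≤ n) :
    IsUnitHInfty (numericalRange (jordanBlock n)) f ↔
      DifferentiableOn ℂ f (Metric.ball 0 (Real.cos (Real.pi / (n + 1)))) ∧
        IsLUB ((fun z => ‖f z‖) '' Metric.ball 0 (Real.cos (Real.pi / (n + 1)))) 1 := by
  rw [IsUnitHInfty, numericalRange_jordanBlock (by omega),
    interior_closedBall _ (cos_pi_div_succ_pos hn).ne']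

theorem norm_matrixFun_jordanBlock_le (hn : 2 ≤ n)
    (hf : IsUnitHInfty (numericalRange (jordanBlock n)) f) :
    ‖matrixFun f (jordanBlock n)‖ ≤ (1 / Real.cos (Real.pi / (n + 1))) ^ (n - 1) := by
  have hc := cos_pi_div_succ_pos hn
  rw [isUnitHInfty_numericalRange_jordanBlock_iff hn] at hf
  have h := norm_matrixFun_smul_jordanBlock_le (n := n) hc
    ((one_le_div hc).2 (cos_pi_div_succ_lt_one n).le) hf.1 fun z hz => hf.2.1 ⟨z, hz, rfl⟩
  rwa [mul_one_div_cancel hc.ne', Complex.ofReal_one, one_smul] at h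

theorem norm_matrixFun_jordanBlock_eq_iff (hn : 2 ≤ n)
    (hf : IsUnitHInfty (numericalRange (jordanBlock n)) f) :
    ‖matrixFun f (jordanBlock n)‖ = (1 / Real.cos (Real.pi / (n + 1))) ^ (n - 1) ↔
      ∃ u : ℂ, ‖u‖ = 1 ∧ ∀ z ∈ Metric.ball (0 : ℂ) (Real.cos (Real.pi / (n + 1))),
        f z = u * jordanConformal n z ^ (n - 1) := by
  have hc := cos_pi_div_succ_pos hn
  rw [isUnitHInfty_numericalRange_jordanBlock_iff hn] at hf
  have h := norm_matrixFun_smul_jordanBlock_eq_iff (n := n) (by omega) hc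
    ((one_lt_div hc).2 (cos_pi_div_succ_lt_one n)) hf.1 fun z hz => hf.2.1 ⟨z, hz, rfl⟩
  rwa [mul_one_div_cancel hc.ne', Complex.ofReal_one, one_smul] at h

theorem bijOn_jordanConformal_ball (hn : 2 ≤ n) :
    Set.BijOn (jordanConformal n) (Metric.ball 0 (Real.cos (Real.pi / (n + 1))))
      (Metric.ball 0 1) := by
  have hc := cos_pi_div_succ_pos hn
  have h := (isConformalOntoDisk_div hc).2.1
  rwa [interior_closedBall _ hc.ne'] at h

theorem isUnitHInfty_comp_jordanConformal_of_eq_monomial (hn : 2 ≤ n) {B : ℂ → ℂ} {u : ℂ}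
    (hu : ‖u‖ = 1) (hB : ∀ z ∈ Metric.ball (0 : ℂ) 1, B z = u * z ^ (n - 1)) :
    IsUnitHInfty (numericalRange (jordanBlock n)) (B ∘ jordanConformal n) := by
  have heq : ∀ z ∈ Metric.ball (0 : ℂ) (Real.cos (Real.pi / (n + 1))),
      (B ∘ jordanConformal n) z = u * jordanConformal n z ^ (n - 1) :=
    fun z hz => hB _ ((bijOn_jordanConformal_ball hn).mapsTo hz)
  refine (isUnitHInfty_numericalRange_jordanBlock_iff hn).2
    ⟨?_, isLUB_norm_monomial (cos_pi_div_succ_pos hn) (n - 1) hu heq⟩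
  refine DifferentiableOn.congr ?_ heq
  unfold jordanConformal
  fun_prop

/-- The monomial is an admissible competitor attaining the universal bound, so any extremal `B` must
attain it too, and the equality case applies. -/
theorem isExtremal_jordanBlock_iff (hn : 2 ≤ n) {B : ℂ → ℂ} :
    IsExtremal (jordanBlock n) (jordanConformal n) B ↔
      ∃ u : ℂ, ‖u‖ = 1 ∧ ∀ z ∈ Metric.ball (0 : ℂ) 1, B z = u * z ^ (n - 1) := by
  constructor
  · rintro ⟨hB, hmax⟩
    have hmono := isUnitHInfty_comp_jordanConformal_of_eq_monomial hn (B := fun z => z ^ (n - 1))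
      norm_one fun z _ => (one_mul _).symm
    have hle := hmax _ hmono
    rw [(norm_matrixFun_jordanBlock_eq_iff hn hmono).2
      ⟨1, norm_one, fun z _ => (one_mul _).symm⟩] at hle
    obtain ⟨u, hu, h⟩ := (norm_matrixFun_jordanBlock_eq_iff hn hB).1
      (le_antisymm (norm_matrixFun_jordanBlock_le hn hB) hle)
    refine ⟨u, hu, fun w hw => ?_⟩
    obtain ⟨z, hz, rfl⟩ := (bijOn_jordanConformal_ball hn).surjOn hw
    exact h z hz
  · rintro ⟨u, hu, h⟩
    have hB := isUnitHInfty_comp_jordanConformal_of_eq_monomial hn hu h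
    refine ⟨hB, fun f hf => ?_⟩
    rw [(norm_matrixFun_jordanBlock_eq_iff hn hB).2
      ⟨u, hu, fun z hz => h _ ((bijOn_jordanConformal_ball hn).mapsTo hz)⟩]
    exact norm_matrixFun_jordanBlock_le hn hf

variable {m : ℕ} {B : ℂ → ℂ}

theorem IsBlaschkeProduct.norm_matrixFun_le (hB : IsBlaschkeProduct m B) (hn : 2 ≤ n) :
    ‖matrixFun B (matrixFun (jordanConformal n) (jordanBlock n))‖
      ≤ (1 / Real.cos (Real.pi / (n + 1))) ^ (n - 1) := by
  have h := norm_matrixFun_smul_jordanBlock_le (n := n) one_pos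
    ((one_le_div (cos_pi_div_succ_pos hn)).2 (cos_pi_div_succ_lt_one n).le) hB.differentiableOn
    fun z hz => hB.norm_le_one (mem_ball_zero_iff.1 hz).le
  rwa [one_mul, ← matrixFun_jordanConformal] at h

theorem IsBlaschkeProduct.norm_matrixFun_eq_iff (hB : IsBlaschkeProduct m B) (hn : 2 ≤ n) :
    ‖matrixFun B (matrixFun (jordanConformal n) (jordanBlock n))‖
        = (1 / Real.cos (Real.pi / (n + 1))) ^ (n - 1) ↔
      ∃ u : ℂ, ‖u‖ = 1 ∧ ∀ z ∈ Metric.ball (0 : ℂ) 1, B z = u * z ^ (n - 1) := by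
  have h := norm_matrixFun_smul_jordanBlock_eq_iff (n := n) (by omega) one_pos
    ((one_lt_div (cos_pi_div_succ_pos hn)).2 (cos_pi_div_succ_lt_one n)) hB.differentiableOn
    fun z hz => hB.norm_le_one (mem_ball_zero_iff.1 hz).le
  simpa only [one_mul, ← matrixFun_jordanConformal, Complex.ofReal_one, div_one] using h

/-- Both sides are continuous on the closed disk, in which the open disk is dense. -/
theorem IsBlaschkeProduct.eq_monomial_on_ball_iff (hB : IsBlaschkeProduct m B) (k : ℕ) :
    (∃ u : ℂ, ‖u‖ = 1 ∧ ∀ z ∈ Metric.ball (0 : ℂ) 1, B z = u * z ^ k) ↔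
      ∃ u : ℂ, ‖u‖ = 1 ∧ ∀ z ∈ Metric.closedBall (0 : ℂ) 1, B z = u * z ^ k := by
  refine exists_congr fun u => and_congr_right fun _ => ⟨fun h => ?_, fun h z hz =>
    h z (Metric.ball_subset_closedBall hz)⟩
  refine Set.EqOn.of_subset_closure (s := Metric.ball (0 : ℂ) 1) h hB.continuousOn (by fun_prop)
    Metric.ball_subset_closedBall ?_
  rw [closure_ball _ one_ne_zero]

end Extremal

theorem mainTheorem2 (n : ℕ) (hn : 2 ≤ n) :
    numericalRange (jordanBlock n) = Metric.closedBall 0 (Real.cos (Real.pi / (n + 1))) ∧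
    IsConformalOntoDisk (numericalRange (jordanBlock n)) (jordanConformal n) ∧
    (∀ (m : ℕ) (B : ℂ → ℂ), IsBlaschkeProduct m B →
      ‖matrixFun B (matrixFun (jordanConformal n) (jordanBlock n))‖
        ≤ (1 / Real.cos (Real.pi / (n + 1))) ^ (n - 1)) ∧
    IsBlaschkeProduct (n - 1) (fun z : ℂ => z ^ (n - 1)) ∧
    ‖matrixFun (fun z : ℂ => z ^ (n - 1)) (matrixFun (jordanConformal n) (jordanBlock n))‖
        = (1 / Real.cos (Real.pi / (n + 1))) ^ (n - 1) ∧
    IsExtremal (jordanBlock n) (jordanConformal n) (fun z : ℂ => z ^ (n - 1)) ∧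
    (∀ (m : ℕ) (B : ℂ → ℂ), m ≤ n - 1 → IsBlaschkeProduct m B →
      (IsExtremal (jordanBlock n) (jordanConformal n) B ↔
        ∃ u : ℂ, ‖u‖ = 1 ∧ ∀ z ∈ Metric.closedBall (0 : ℂ) 1, B z = u * z ^ (n - 1)) ∧
      (‖matrixFun B (matrixFun (jordanConformal n) (jordanBlock n))‖
          = (1 / Real.cos (Real.pi / (n + 1))) ^ (n - 1) ↔
        ∃ u : ℂ, ‖u‖ = 1 ∧ ∀ z ∈ Metric.closedBall (0 : ℂ) 1, B z = u * z ^ (n - 1))) := by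
  have hmono := isBlaschkeProduct_pow (n - 1)
  refine ⟨numericalRange_jordanBlock (by omega), ?_, fun m B hB => hB.norm_matrixFun_le hn, hmono,
    (hmono.norm_matrixFun_eq_iff hn).2 ⟨1, norm_one, fun z _ => (one_mul _).symm⟩,
    (isExtremal_jordanBlock_iff hn).2 ⟨1, norm_one, fun z _ => (one_mul _).symm⟩,
    fun m B _ hB => ⟨?_, ?_⟩⟩
  · rw [numericalRange_jordanBlock (by omega)]
    exact isConformalOntoDisk_div (cos_pi_div_succ_pos hn)
  · exact (isExtremal_jordanBlock_iff hn).trans (hB.eq_monomial_on_ball_iff (n - 1))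
  · exact (hB.norm_matrixFun_eq_iff hn).trans (hB.eq_monomial_on_ball_iff (n - 1))
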